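/- There is an absolute constant $C>0$ with the following property. Let $n \ge 2$, let $\alpha \ge 1$ and $\beta$ be real numbers, and let $P \subset \mathbb{R}^n$ be a (rational) polytope, i.e. the convex hull of finitely many points, such that every coordinate of every vertex of $P$ can be written as a fraction $p/q$ with integers $p,q$ satisfying $|p| \le \alpha$ and $1 \le q \le \beta$. Let $(U,V)$ be a uniformly random orthonormal pair of vectors in $\mathbb{R}^n$ (that is, distributed according to the unique probability measure on pairs of orthonormal vectors that is invariant under all linear isometries of $\mathbb{R}^n$; equivalently, the Gram–Schmidt orthonormalization of two independent standard Gaussian vectors), and let $\pi(x) = (U^{\intercal}x, V^{\intercal}x)$. Then the number of vertices of the shadow $\pi(P) \subset \mathbb{R}^2$ is an integrable random variable, and $$\mathbb{E}\big[\#\{\text{vertices of } \pi(P)\}\big] \le C\, n\, \beta^2\, \alpha .$$ -/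

import Mathlib

open MeasureTheory ProbabilityTheory

noncomputable section

namespace RandomShadow

/-- A polytope in `ℝⁿ`: the convex hull of finitely many points. -/
def IsPolytope {n : ℕ} (P : Set (EuclideanSpace ℝ (Fin n))) : Prop :=
  ∃ s : Finset (EuclideanSpace ℝ (Fin n)), P = convexHull ℝ (s : Set (EuclideanSpace ℝ (Fin n)))

/-- The vertices of a polytope. -/
def vertices {n : ℕ} (P : Set (EuclideanSpace ℝ (Fin n))) : Set (EuclideanSpace ℝ (Fin n)) :=
  P.extremePoints ℝ

/-- The shadow `{(Uᵀx, Vᵀx) : x ∈ P}` of `P`, for a pair `F = (U, V)`. -/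
def shadow {n : ℕ} (P : Set (EuclideanSpace ℝ (Fin n)))
    (F : EuclideanSpace ℝ (Fin n) × EuclideanSpace ℝ (Fin n)) : Set (EuclideanSpace ℝ (Fin 2)) :=
  (fun x => !₂[inner ℝ F.1 x, inner ℝ F.2 x]) '' P

/-- The size of a shadow: its number of vertices. -/
def shadowSize {n : ℕ} (P : Set (EuclideanSpace ℝ (Fin n)))
    (F : EuclideanSpace ℝ (Fin n) × EuclideanSpace ℝ (Fin n)) : ℕ :=
  (vertices (shadow P F)).ncard

/-- The Gram–Schmidt orthonormalization of a pair of vectors. -/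
def orthonormalize {n : ℕ} (G : EuclideanSpace ℝ (Fin n) × EuclideanSpace ℝ (Fin n)) :
    EuclideanSpace ℝ (Fin n) × EuclideanSpace ℝ (Fin n) :=
  let u := ‖G.1‖⁻¹ • G.1
  let w := G.2 - inner ℝ u G.2 • u
  (u, ‖w‖⁻¹ • w)

/-- The uniform distribution on pairs `(U, V)` of orthonormal vectors in `ℝⁿ`, `n ≥ 2`: the law of
the orthonormalization of two independent standard Gaussian vectors. The lemmas below confirm that
it is a probability measure, concentrated on orthonormal pairs, and invariant under all linear
isometries of `ℝⁿ`. -/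
def uniformFrame (n : ℕ) :
    Measure (EuclideanSpace ℝ (Fin n) × EuclideanSpace ℝ (Fin n)) :=
  ((stdGaussian (EuclideanSpace ℝ (Fin n))).prod
    (stdGaussian (EuclideanSpace ℝ (Fin n)))).map orthonormalize

theorem measurable_orthonormalize {n : ℕ} : Measurable (orthonormalize (n := n)) := by
  unfold orthonormalize
  fun_prop

instance isProbabilityMeasure_uniformFrame (n : ℕ) : IsProbabilityMeasure (uniformFrame n) :=
  Measure.isProbabilityMeasure_map measurable_orthonormalize.aemeasurable

theorem uniformFrame_map_isometry {n : ℕ}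
    (e : EuclideanSpace ℝ (Fin n) ≃ₗᵢ[ℝ] EuclideanSpace ℝ (Fin n)) :
    (uniformFrame n).map (Prod.map e e) = uniformFrame n := by
  have he : Measurable e := e.continuous.measurable
  have h1 : (Prod.map e e) ∘ orthonormalize (n := n) = orthonormalize ∘ (Prod.map e e) := by
    funext G
    have hi : ∀ x y, inner ℝ (e x) (e y) = inner ℝ x y := e.inner_map_map
    simp only [Function.comp, orthonormalize, Prod.map, e.norm_map, ← map_smul, hi, ← map_sub]
  rw [uniformFrame, Measure.map_map (he.prodMap he) measurable_orthonormalize, h1,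
    ← Measure.map_map measurable_orthonormalize (he.prodMap he),
    ← Measure.map_prod_map _ _ he he, stdGaussian_map]

theorem stdGaussian_hyperplane {n : ℕ} (e : EuclideanSpace ℝ (Fin n)) (he : e ≠ 0) :
    stdGaussian (EuclideanSpace ℝ (Fin n)) {x | inner ℝ e x = 0} = 0 := by
  have hL : Measurable (innerSL ℝ e) := by fun_prop
  have hm : (stdGaussian (EuclideanSpace ℝ (Fin n))).map (innerSL ℝ e) =
      gaussianReal 0 (‖e‖ ^ 2).toNNReal := by
    rw [IsGaussian.map_eq_gaussianReal, integral_strongDual_stdGaussian,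
      variance_dual_stdGaussian, innerSL_apply_norm]
  have hv : (‖e‖ ^ 2).toNNReal ≠ 0 := by
    have : 0 < ‖e‖ := norm_pos_iff.2 he
    simp [he]
  have := nullSingletonClass_gaussianReal (μ := 0) hv
  have h0 : gaussianReal 0 (‖e‖ ^ 2).toNNReal {0} = 0 := measure_singleton _
  rw [← hm, Measure.map_apply hL (measurableSet_singleton _)] at h0
  exact h0

theorem uniformFrame_orthonormal {n : ℕ} (hn : 2 ≤ n) :
    ∀ᵐ F ∂(uniformFrame n), ‖F.1‖ = 1 ∧ ‖F.2‖ = 1 ∧ inner ℝ F.1 F.2 = 0 := by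
  have hms : MeasurableSet {F : EuclideanSpace ℝ (Fin n) × EuclideanSpace ℝ (Fin n) |
      ‖F.1‖ = 1 ∧ ‖F.2‖ = 1 ∧ inner ℝ F.1 F.2 = 0} := by
    apply IsClosed.measurableSet
    refine (isClosed_eq (by fun_prop) (by fun_prop)).inter
      ((isClosed_eq (by fun_prop) (by fun_prop)).inter (isClosed_eq (by fun_prop) (by fun_prop)))
  rw [uniformFrame, ae_map_iff measurable_orthonormalize.aemeasurable hms]
  have hms' := measurable_orthonormalize hms
  refine (Measure.ae_prod_iff_ae_ae hms').2 ?_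
  have hne : ∀ᵐ g ∂(stdGaussian (EuclideanSpace ℝ (Fin n))), g ≠ 0 := by
    have h := stdGaussian_hyperplane
      (EuclideanSpace.single (⟨0, by omega⟩ : Fin n) (1 : ℝ)) (by simp)
    filter_upwards [measure_eq_zero_iff_ae_notMem.1 h] with g hg h0
    exact hg (by simp [h0])
  filter_upwards [hne] with g hg
  obtain ⟨e, he0, heg⟩ : ∃ e : EuclideanSpace ℝ (Fin n), e ≠ 0 ∧ inner ℝ e g = 0 := by
    have hlt : Module.finrank ℝ (Submodule.span ℝ {g}) <
        Module.finrank ℝ (EuclideanSpace ℝ (Fin n)) := by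
      rw [finrank_span_singleton hg, finrank_euclideanSpace_fin]; omega
    have hb : (Submodule.span ℝ {g})ᗮ ≠ ⊥ := by
      intro h
      rw [Submodule.orthogonal_eq_bot_iff] at h
      rw [h, finrank_top] at hlt
      exact lt_irrefl _ hlt
    obtain ⟨e, he, he0⟩ := Submodule.exists_mem_ne_zero_of_ne_bot hb
    exact ⟨e, he0, Submodule.mem_orthogonal_singleton_iff_inner_left.1 he⟩
  filter_upwards [measure_eq_zero_iff_ae_notMem.1 (stdGaussian_hyperplane e he0)] with h hh
  have hg' : ‖g‖ ≠ 0 := norm_ne_zero_iff.2 hg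
  have hu : ‖‖g‖⁻¹ • g‖ = 1 := by rw [norm_smul, norm_inv, norm_norm, inv_mul_cancel₀ hg']
  have huu : inner ℝ (‖g‖⁻¹ • g) (‖g‖⁻¹ • g) = 1 := by
    rw [real_inner_self_eq_norm_sq, hu, one_pow]
  have hw : h - inner ℝ (‖g‖⁻¹ • g) h • (‖g‖⁻¹ • g) ≠ 0 := by
    intro h0
    apply hh
    rw [sub_eq_zero] at h0
    change inner ℝ e h = 0
    rw [h0, inner_smul_right, inner_smul_right, heg, mul_zero, mul_zero]
  refine ⟨hu, ?_, ?_⟩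
  · simp only [orthonormalize]
    rw [norm_smul, norm_inv, norm_norm, inv_mul_cancel₀ (norm_ne_zero_iff.2 hw)]
  · simp only [orthonormalize]
    rw [inner_smul_right, inner_sub_right, inner_smul_right, huu, mul_one, sub_self, mul_zero]

end RandomShadow

end

open scoped ENNReal

/-! The argument charges each shadow vertex to an edge and compares the number of edges with the
total horizontal length they cover. For independent Gaussians `g`, `h`, view the shadow in
coordinates `(⟨g, w⟩, ⟨h, w⟩)`; Gram–Schmidt only changes the basis of the span, so it creates no
new vertices. Every vertex except the leftmost is the right endpoint of an upper or a lower hull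
edge (`sum_strictMaxSet_le`), and `h ↦ -h` exchanges the two kinds. Hence the expectation is at most
`1 + 2R`, where `R` sums, over pairs `(u, v)`, the probability that `uv` projects to an upper edge.

The probabilistic core is `lintegral_normalEvent`. Put `e = v - u`. The edge is upper when `⟨g, e⟩ >
0` and `⟨g, e⟩ h - ⟨h, e⟩ g`, a vector orthogonal to `e`, lies in the normal cone at `v`. Its
direction is independent of the components of `g` and `h` along `e`. So the expected horizontal
length of the edge, restricted to this event, is at least `‖e‖ E[s⁺]` times the probability of the
event (`measure_normalEvent_mul_le`), `s` being a standard real Gaussian.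

Upper edges project to disjoint intervals inside the range of `⟨g, ·⟩` (`sum_isUpperEdge_le`), which
has length at most `2α‖g‖₁`, with expectation `2αn E|s|`. Distinct vertices differ in some
coordinate by at least `β⁻²`, so `R β⁻² E[s⁺] ≤ 2αn E|s|`. -/

namespace RandomShadow

/-! ### Gaussian vectors: resampling along a direction and independence of the edge normal. -/

section Gaussian

variable {E G : Type*} [NormedAddCommGroup E] [InnerProductSpace ℝ E]
  [NormedAddCommGroup G] [InnerProductSpace ℝ G]

/-- Replace the component of `p.1` in the direction of the unit vector `e` by `p.2`. -/
noncomputable def replaceComponent (e : E) (p : E × ℝ) : E := p.1 - inner ℝ e p.1 • e + p.2 • e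

theorem inner_replaceComponent {e : E} (he : ‖e‖ = 1) (p : E × ℝ) :
    inner ℝ (replaceComponent e p) e = p.2 := by
  rw [replaceComponent, inner_add_left, inner_sub_left, inner_smul_left, inner_smul_left,
    real_inner_self_eq_norm_sq, he, real_inner_comm e p.1]
  simp

theorem charFun_map_eq_of_inner [MeasurableSpace E]
    [MeasurableSpace G] [BorelSpace G] [SecondCountableTopology G] {μ : Measure E} {f : E → G} (hf : Measurable f) {t : G} {t' : E}
    (h : ∀ x, inner ℝ (f x) t = inner ℝ x t') : charFun (μ.map f) t = charFun μ t' := by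
  rw [charFun_apply, charFun_apply, integral_map hf.aemeasurable]
  · simp only [h]
  · exact (Continuous.aestronglyMeasurable (by fun_prop))

end Gaussian

section Gaussian

variable {E F G : Type*}
  [NormedAddCommGroup E] [InnerProductSpace ℝ E] [FiniteDimensional ℝ E]
  [MeasurableSpace E] [BorelSpace E]
  [NormedAddCommGroup F] [InnerProductSpace ℝ F] [FiniteDimensional ℝ F]
  [MeasurableSpace F] [BorelSpace F]
  [NormedAddCommGroup G] [InnerProductSpace ℝ G] [FiniteDimensional ℝ G]
  [MeasurableSpace G] [BorelSpace G]

/-- Compare characteristic functions: `f'` and `g'` act as adjoints of `f` and `g`, so independence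
gives `exp (-(‖f' t‖² + ‖g' t‖²) / 2)` on the left. -/
theorem stdGaussian_prod_map_add {f : E → G} {g : F → G} (hf : Measurable f) (hg : Measurable g)
    {f' : G → E} {g' : G → F} (hff : ∀ x t, inner ℝ (f x) t = inner ℝ x (f' t))
    (hgg : ∀ x t, inner ℝ (g x) t = inner ℝ x (g' t)) (r : ℝ)
    (hr : ∀ t, ‖f' t‖ ^ 2 + ‖g' t‖ ^ 2 = r ^ 2 * ‖t‖ ^ 2) :
    ((stdGaussian E).prod (stdGaussian F)).map (fun p => f p.1 + g p.2) =
      (stdGaussian G).map (fun x => r • x) := by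
  have h1 : ((stdGaussian E).prod (stdGaussian F)).map (fun p => f p.1 + g p.2) =
      (((stdGaussian E).map f).prod ((stdGaussian F).map g)).map (fun p => p.1 + p.2) := by
    rw [Measure.map_prod_map _ _ hf hg, Measure.map_map (by fun_prop) (hf.prodMap hg)]
    rfl
  have := Measure.isProbabilityMeasure_map (μ := stdGaussian E) hf.aemeasurable
  have := Measure.isProbabilityMeasure_map (μ := stdGaussian F) hg.aemeasurable
  rw [h1]
  apply Measure.ext_of_charFun
  ext t
  rw [charFun_map_add_prod_eq_mul, Pi.mul_apply, charFun_map_eq_of_inner hf fun x => hff x t,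
    charFun_map_eq_of_inner hg fun x => hgg x t, charFun_map_smul, charFun_stdGaussian,
    charFun_stdGaussian, charFun_stdGaussian, ← Complex.exp_add]
  have h2 : ‖r • t‖ ^ 2 = ‖f' t‖ ^ 2 + ‖g' t‖ ^ 2 := by
    rw [hr, norm_smul, mul_pow, Real.norm_eq_abs, sq_abs]
  congr 1
  norm_cast
  rw [h2]
  ring

theorem measurable_replaceComponent (e : E) : Measurable (replaceComponent e) := by
  unfold replaceComponent
  fun_prop

theorem stdGaussian_prod_map_replaceComponent {e : E} (he : ‖e‖ = 1) :
    ((stdGaussian E).prod (stdGaussian ℝ)).map (replaceComponent e) = stdGaussian E := by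
  have h := stdGaussian_prod_map_add (E := E) (F := ℝ) (G := E)
    (f := fun x => x - inner ℝ e x • e) (g := fun s => s • e) (by fun_prop) (by fun_prop)
    (f' := fun x => x - inner ℝ e x • e) (g' := fun t => inner ℝ e t)
    (fun x t => by
      rw [inner_sub_left, inner_sub_right, inner_smul_left, inner_smul_right,
        real_inner_comm e x]
      simp [mul_comm])
    (fun s t => by simp [inner_smul_left, mul_comm]) 1
    (fun t => by
      rw [norm_sub_sq_real, norm_smul, he, inner_smul_right, real_inner_comm e t, mul_one,
        Real.norm_eq_abs, sq_abs]
      ring)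
  simpa [replaceComponent, Function.comp_def] using! h

theorem stdGaussian_prod_map_lincomb (s t : ℝ) :
    ((stdGaussian E).prod (stdGaussian E)).map (fun p => s • p.2 - t • p.1) =
      (stdGaussian E).map (fun x => √(s ^ 2 + t ^ 2) • x) := by
  rw [← stdGaussian_prod_map_add (E := E) (F := E) (G := E)
    (f := fun x => -t • x) (g := fun x => s • x) (by fun_prop) (by fun_prop)
    (f' := fun x => -t • x) (g' := fun x => s • x)
    (fun x t => by rw [inner_smul_left, inner_smul_right]; rfl)
    (fun x t => by rw [inner_smul_left, inner_smul_right]; rfl)]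
  · congr 1
    ext p
    rw [neg_smul]
    abel
  · intro x
    rw [Real.sq_sqrt (by positivity), norm_smul, norm_smul, mul_pow, mul_pow]
    simp
    ring

/-- Makes the components along `e` of both Gaussians the outer variables, so that they can be frozen
while the rest is integrated. -/
theorem lintegral_stdGaussian_prod {e : E} (he : ‖e‖ = 1) {f : E × E → ℝ≥0∞} (hf : Measurable f) :
    ∫⁻ p, f p ∂((stdGaussian E).prod (stdGaussian E)) =
      ∫⁻ q, ∫⁻ p, f (replaceComponent e (p.1, q.1), replaceComponent e (p.2, q.2))
        ∂((stdGaussian E).prod (stdGaussian E)) ∂((stdGaussian ℝ).prod (stdGaussian ℝ)) := by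
  have hT := measurable_replaceComponent e
  conv_lhs => rw [← stdGaussian_prod_map_replaceComponent he]
  rw [Measure.map_prod_map _ _ hT hT, lintegral_map hf (hT.prodMap hT), lintegral_prod _ (by fun_prop),
    lintegral_prod_symm _ (by
      apply Measurable.aemeasurable
      exact Measurable.lintegral_prod_right' (f := fun z : (E × ℝ) × E × ℝ =>
        f (replaceComponent e z.1, replaceComponent e z.2)) (by fun_prop))]
  have hm : Measurable fun z : (E × ℝ) × E × ℝ =>
    f (replaceComponent e z.1, replaceComponent e z.2) := by fun_prop
  simp only [Prod.map]
  calc _ = ∫⁻ s, ∫⁻ g, ∫⁻ z, f (replaceComponent e (g, s), replaceComponent e z)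
        ∂((stdGaussian E).prod (stdGaussian ℝ)) ∂(stdGaussian E) ∂(stdGaussian ℝ) := rfl
    _ = ∫⁻ s, ∫⁻ g, ∫⁻ t, ∫⁻ h, f (replaceComponent e (g, s), replaceComponent e (h, t))
        ∂(stdGaussian E) ∂(stdGaussian ℝ) ∂(stdGaussian E) ∂(stdGaussian ℝ) := by
      congr! with s g
      exact lintegral_prod_symm' _ (by fun_prop)
    _ = ∫⁻ s, ∫⁻ t, ∫⁻ g, ∫⁻ h, f (replaceComponent e (g, s), replaceComponent e (h, t))
        ∂(stdGaussian E) ∂(stdGaussian E) ∂(stdGaussian ℝ) ∂(stdGaussian ℝ) := by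
      congr! 2 with s
      refine lintegral_lintegral_swap ?_
      apply Measurable.aemeasurable
      exact Measurable.lintegral_prod_right' (f := fun z : (E × ℝ) × E =>
        f (replaceComponent e (z.1.1, s), replaceComponent e (z.2, z.1.2))) (by fun_prop)
    _ = ∫⁻ s, ∫⁻ t, ∫⁻ p, f (replaceComponent e (p.1, s), replaceComponent e (p.2, t))
        ∂((stdGaussian E).prod (stdGaussian E)) ∂(stdGaussian ℝ) ∂(stdGaussian ℝ) := by
      congr! with s t
      exact (lintegral_prod (fun p : E × E =>
        f (replaceComponent e (p.1, s), replaceComponent e (p.2, t))) (by fun_prop)).symm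
    _ = _ := by
      rw [lintegral_prod]
      apply Measurable.aemeasurable
      exact Measurable.lintegral_prod_right' (f := fun z : (ℝ × ℝ) × E × E =>
        f (replaceComponent e (z.2.1, z.1.1), replaceComponent e (z.2.2, z.1.2))) (by fun_prop)

/-- The event that the edge direction `e` points to the right and the normal vector to `e` in the
plane of `g` and `h` lies in `K`. -/
def normalEvent (e : E) (K : Set E) : Set (E × E) :=
  {p | 0 < inner ℝ p.1 e ∧ inner ℝ p.1 e • p.2 - inner ℝ p.2 e • p.1 ∈ K}

theorem measurableSet_normalEvent (e : E) {K : Set E} (hK : MeasurableSet K) :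
    MeasurableSet (normalEvent e K) := by
  have h1 : Measurable fun p : E × E => inner ℝ p.1 e := by fun_prop
  have h2 : Measurable fun p : E × E => inner ℝ p.1 e • p.2 - inner ℝ p.2 e • p.1 := by fun_prop
  exact (measurableSet_lt measurable_const h1).inter (h2 hK)

/-- The expected positive part of a standard Gaussian. -/
noncomputable def gaussianPosPart : ℝ≥0∞ := ∫⁻ s, ENNReal.ofReal s ∂(stdGaussian ℝ)

/-- With components `s > 0` and `t` along `e` frozen, the normal is a positive multiple of the
projection of `s • h - t • g` to the complement of `e`. That combination is Gaussian up to the scale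
`√(s² + t²)`, which a cone ignores. The inner probability therefore does not depend on `(s, t)`, and
the integral factors. -/
theorem lintegral_normalEvent {e : E} (he : e ≠ 0) {K : Set E} (hK : MeasurableSet K)
    (hcone : ∀ r : ℝ, 0 < r → ∀ x, r • x ∈ K ↔ x ∈ K) {φ : ℝ → ℝ≥0∞} (hφ : Measurable φ) :
    ∫⁻ p, (normalEvent e K).indicator (fun p => φ (inner ℝ p.1 e)) p
        ∂((stdGaussian E).prod (stdGaussian E)) =
      (∫⁻ s, (Set.Ioi 0).indicator (fun s => φ (‖e‖ * s)) s ∂(stdGaussian ℝ)) *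
        stdGaussian E {x | x - inner ℝ (‖e‖⁻¹ • e) x • (‖e‖⁻¹ • e) ∈ K} := by
  have hne : 0 < ‖e‖ := norm_pos_iff.2 he
  set u := ‖e‖⁻¹ • e with hu
  have hu1 : ‖u‖ = 1 := by rw [hu, norm_smul, norm_inv, norm_norm, inv_mul_cancel₀ hne.ne']
  have heu : e = ‖e‖ • u := by rw [hu, smul_smul, mul_inv_cancel₀ hne.ne', one_smul]
  have hmE := measurableSet_normalEvent e hK
  set A : Set E := {x | x - inner ℝ u x • u ∈ K} with hA
  have hAm : MeasurableSet A :=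
    (show Measurable fun x : E => x - inner ℝ u x • u by fun_prop) hK
  have hAc : ∀ r : ℝ, 0 < r → ∀ x, r • x ∈ A ↔ x ∈ A := by
    intro r hr x
    rw [hA, Set.mem_ofPred_eq, Set.mem_ofPred_eq, inner_smul_right, mul_smul, ← smul_sub, hcone r hr]
  have hin : ∀ g : E, ∀ s : ℝ, inner ℝ (replaceComponent u (g, s)) e = ‖e‖ * s := by
    intro g s
    conv_lhs => rw [heu]
    rw [inner_smul_right, inner_replaceComponent hu1]
  rw [lintegral_stdGaussian_prod hu1 ((by fun_prop : Measurable fun p : E × E =>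
    φ (inner ℝ p.1 e)).indicator hmE)]
  have key : ∀ q : ℝ × ℝ,
      ∫⁻ p, (normalEvent e K).indicator (fun p => φ (inner ℝ p.1 e))
        (replaceComponent u (p.1, q.1), replaceComponent u (p.2, q.2))
          ∂((stdGaussian E).prod (stdGaussian E)) =
        (Set.Ioi 0).indicator (fun s => φ (‖e‖ * s)) q.1 * stdGaussian E A := by
    rintro ⟨s, t⟩
    by_cases hs : 0 < s
    · have hiff : ∀ p : E × E,
          ((replaceComponent u (p.1, s), replaceComponent u (p.2, t)) ∈ normalEvent e K) ↔
            s • p.2 - t • p.1 ∈ A := by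
        intro p
        simp only [normalEvent, hA, Set.mem_ofPred_eq, hin]
        -- The normal equals `‖e‖` times the projected combination; the cone property removes this
        -- factor.
        rw [and_iff_right (mul_pos hne hs), ← hcone ‖e‖ hne (_ - inner ℝ u _ • u)]
        congr! 1
        simp only [replaceComponent, inner_sub_right, inner_smul_right]
        module
      have hm : Measurable fun p : E × E => s • p.2 - t • p.1 := by fun_prop
      rw [Set.indicator_of_mem (show s ∈ Set.Ioi (0 : ℝ) from hs)]
      have h2 : ∀ p : E × E, (normalEvent e K).indicator (fun p => φ (inner ℝ p.1 e))
          (replaceComponent u (p.1, s), replaceComponent u (p.2, t)) =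
          ((fun p : E × E => s • p.2 - t • p.1) ⁻¹' A).indicator (fun _ => φ (‖e‖ * s)) p := by
        intro p
        by_cases hp : s • p.2 - t • p.1 ∈ A
        · rw [Set.indicator_of_mem ((hiff p).2 hp), Set.indicator_of_mem (by exact hp), hin]
        · rw [Set.indicator_of_notMem (fun h => hp ((hiff p).1 h)),
            Set.indicator_of_notMem (by exact hp)]
      simp only [h2]
      rw [lintegral_indicator_const (hm hAm), ← Measure.map_apply hm hAm,
        stdGaussian_prod_map_lincomb, Measure.map_apply (by fun_prop) hAm]
      congr 2
      ext x
      exact hAc _ (Real.sqrt_pos.2 (by positivity)) x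
    · rw [Set.indicator_of_notMem (show s ∉ Set.Ioi (0 : ℝ) from hs), zero_mul]
      have : ∀ p : E × E, (normalEvent e K).indicator (fun p => φ (inner ℝ p.1 e))
        (replaceComponent u (p.1, s), replaceComponent u (p.2, t)) = 0 := by
        intro p
        apply Set.indicator_of_notMem
        intro h
        have h1 := h.1
        simp only [hin] at h1
        exact hs (pos_of_mul_pos_right h1 hne.le)
      simp [this]
  simp only [key]
  have hmi : Measurable ((Set.Ioi (0 : ℝ)).indicator (fun s => φ (‖e‖ * s))) :=
    (by fun_prop : Measurable fun s => φ (‖e‖ * s)).indicator measurableSet_Ioi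
  rw [lintegral_mul_const _ (by fun_prop), lintegral_prod _ (by fun_prop)]
  simp

/-- Apply `lintegral_normalEvent` to the constant `1` and to `ENNReal.ofReal`; the factor `P(s > 0)`
is simply bounded by `1`. -/
theorem measure_normalEvent_mul_le {e : E} (he : e ≠ 0) {K : Set E} (hK : MeasurableSet K)
    (hcone : ∀ r : ℝ, 0 < r → ∀ x, r • x ∈ K ↔ x ∈ K) :
    ((stdGaussian E).prod (stdGaussian E)) (normalEvent e K) *
        (ENNReal.ofReal ‖e‖ * gaussianPosPart) ≤
      ∫⁻ p, (normalEvent e K).indicator (fun p => ENNReal.ofReal (inner ℝ p.1 e)) p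
        ∂((stdGaussian E).prod (stdGaussian E)) := by
  have h1 := lintegral_normalEvent he hK hcone (φ := fun _ => 1) measurable_const
  rw [lintegral_indicator_const (measurableSet_normalEvent e hK), one_mul,
    lintegral_indicator_const measurableSet_Ioi, one_mul] at h1
  rw [lintegral_normalEvent he hK hcone ENNReal.measurable_ofReal, h1]
  have h2 : ∫⁻ s, (Set.Ioi 0).indicator (fun s => ENNReal.ofReal (‖e‖ * s)) s ∂(stdGaussian ℝ) =
      ENNReal.ofReal ‖e‖ * gaussianPosPart := by
    rw [gaussianPosPart, ← lintegral_const_mul _ (by fun_prop)]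
    congr! with s
    rw [← ENNReal.ofReal_mul (norm_nonneg e)]
    by_cases hs : 0 < s
    · exact Set.indicator_of_mem (show s ∈ Set.Ioi (0 : ℝ) from hs) _
    · rw [Set.indicator_of_notMem (show s ∉ Set.Ioi (0 : ℝ) from hs),
        ENNReal.ofReal_of_nonpos (mul_nonpos_of_nonneg_of_nonpos (norm_nonneg e) (not_lt.1 hs))]
  rw [h2, mul_comm]
  gcongr
  exact mul_le_of_le_one_left zero_le prob_le_one

/-- The expected absolute value of a standard Gaussian. -/
noncomputable def gaussianAbs : ℝ≥0∞ := ∫⁻ s, ENNReal.ofReal |s| ∂(stdGaussian ℝ)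

theorem gaussianAbs_ne_top : gaussianAbs ≠ ∞ := by
  have h : Integrable (fun s : ℝ => s) (stdGaussian ℝ) := IsGaussian.integrable_fun_id
  have := h.2
  rw [hasFiniteIntegral_iff_norm] at this
  exact this.ne

theorem stdGaussian_real_map_neg : (stdGaussian ℝ).map (fun x => -x) = stdGaussian ℝ :=
  stdGaussian_map (LinearIsometryEquiv.neg ℝ (E := ℝ))

/-- Otherwise `s ≤ 0` almost surely, hence `s = 0` almost surely by symmetry, but the Gaussian has
no atom. -/
theorem gaussianPosPart_ne_zero : gaussianPosPart ≠ 0 := by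
  intro h
  have h0 : stdGaussian ℝ {x | inner ℝ 1 x = 0} = 0 := by
    have hm : (stdGaussian ℝ) = gaussianReal 0 1 := by
      apply Measure.ext_of_charFun
      ext t
      rw [charFun_stdGaussian, charFun_gaussianReal]
      simp [neg_div, ← Complex.ofReal_pow]
    have := nullSingletonClass_gaussianReal (μ := 0) (v := 1) one_ne_zero
    rw [hm]
    simp
  have h1 : ∀ᵐ s ∂(stdGaussian ℝ), s ≤ 0 := by
    filter_upwards [(lintegral_eq_zero_iff (by fun_prop)).1 h] with s hs
    exact ENNReal.ofReal_eq_zero.1 hs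
  have h2 : ∀ᵐ s ∂(stdGaussian ℝ), -s ≤ 0 := by
    rw [← stdGaussian_real_map_neg, ae_map_iff (by fun_prop) measurableSet_Iic] at h1
    exact h1
  have h3 : ∀ᵐ s ∂(stdGaussian ℝ), False := by
    filter_upwards [h1, h2, measure_eq_zero_iff_ae_notMem.1 h0] with s hs1 hs2 hs3
    exact hs3 (by simp; linarith)
  simp at h3
  exact (IsProbabilityMeasure.ne_zero (stdGaussian ℝ)) h3

theorem gaussianPosPart_ne_top : gaussianPosPart ≠ ∞ :=
  ne_top_of_le_ne_top gaussianAbs_ne_top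
    (lintegral_mono fun s => ENNReal.ofReal_le_ofReal (le_abs_self s))

theorem lintegral_abs_apply_stdGaussian {n : ℕ} (i : Fin n) :
    ∫⁻ g, ENNReal.ofReal |g i| ∂(stdGaussian (EuclideanSpace ℝ (Fin n))) = gaussianAbs := by
  have hm : (stdGaussian (EuclideanSpace ℝ (Fin n))).map (fun g => g i) = stdGaussian ℝ := by
    apply Measure.ext_of_charFun
    ext t
    rw [charFun_map_eq_of_inner (t' := EuclideanSpace.single i t) (by fun_prop)
      (fun x => by rw [EuclideanSpace.inner_single_right]; simp), charFun_stdGaussian, charFun_stdGaussian]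
    simp
  rw [gaussianAbs, ← hm, lintegral_map (by fun_prop) (by fun_prop)]

end Gaussian

/-! ### Upper hull edges of a finite planar configuration. -/

section Planar

variable {V : Type*} {S : Finset V} {x y : V → ℝ}

/-- The segment from the point of `u` to the point of `v` points to the right, and the points
`(x w, y w)` for `w ∈ S` lie on or below the line through it. -/
def IsUpperEdge (S : Finset V) (x y : V → ℝ) (u v : V) : Prop :=
  x u < x v ∧ ∀ w ∈ S, (x v - x u) * (y w - y v) ≤ (y v - y u) * (x w - x v)

/-- Among the points left of `v`, the one whose segment to `v` has least slope works. Minimality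
controls the points to the left; the functional strictly maximized at `v`, having `d ≥ 0`, controls
those to the right. -/
theorem exists_isUpperEdge {u v : V} (hx : Set.InjOn x S) (hv : v ∈ S) (hu : u ∈ S)
    (huv : x u < x v) {c d : ℝ} (hd : 0 ≤ d)
    (h : ∀ w ∈ S, w ≠ v → c * (x w - x v) + d * (y w - y v) < 0) :
    ∃ u ∈ S, IsUpperEdge S x y u v := by
  obtain ⟨a, ha, hmin⟩ := (S.filter fun w => x w < x v).exists_min_image
    (fun w => (y v - y w) / (x v - x w)) ⟨u, by simp [hu, huv]⟩
  rw [Finset.mem_filter] at ha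
  have hav : 0 < x v - x a := sub_pos.2 ha.2
  refine ⟨a, ha.1, ha.2, fun w hw => ?_⟩
  have hna := h a ha.1 (by rintro rfl; exact lt_irrefl _ ha.2)
  rcases lt_trichotomy (x w) (x v) with hlt | heq | hgt
  · have h1 := hmin w (by simp [hw, hlt])
    rw [div_le_div_iff₀ hav (sub_pos.2 hlt)] at h1
    linarith
  · have : w = v := hx hw hv heq
    simp [this]
  · have hnw := h w hw (by rintro rfl; exact lt_irrefl _ hgt)
    have hwv : 0 < x w - x v := sub_pos.2 hgt
    rcases hd.eq_or_lt with rfl | hd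
    · nlinarith
    · have h1 : d * ((x v - x a) * (y w - y v) - (y v - y a) * (x w - x v)) < 0 := by
        nlinarith [mul_lt_mul_of_pos_left hnw hav, mul_lt_mul_of_pos_left hna hwv]
      have := neg_of_mul_neg_right h1 hd.le
      linarith

/-- The difference `D + (r - s) x` of the two supporting lines is nonnegative at `x a`, `x b` and
nonpositive at `x c`, `x d`. Overlapping intervals force it to vanish, so all four points share a
line, which contains only two points of `S`. -/
theorem IsUpperEdge.eq_of_mem_Ioo (hS : ∀ u ∈ S, ∀ v ∈ S, ∀ w ∈ S, u ≠ v → u ≠ w → v ≠ w →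
      (x v - x u) * (y w - y u) ≠ (y v - y u) * (x w - x u))
    {a b c d : V} (ha : a ∈ S) (hb : b ∈ S) (hc : c ∈ S) (hd : d ∈ S)
    (h1 : IsUpperEdge S x y a b) (h2 : IsUpperEdge S x y c d) {t : ℝ}
    (ht1 : t ∈ Set.Ioo (x a) (x b)) (ht2 : t ∈ Set.Ioo (x c) (x d)) : a = c ∧ b = d := by
  obtain ⟨hab, h1⟩ := h1
  obtain ⟨hcd, h2⟩ := h2
  obtain ⟨hat, htb⟩ := ht1
  obtain ⟨hct, htd⟩ := ht2
  have hab' : 0 < x b - x a := sub_pos.2 hab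
  have hcd' : 0 < x d - x c := sub_pos.2 hcd
  obtain ⟨s, hs⟩ : ∃ s, y b - y a = s * (x b - x a) :=
    ⟨(y b - y a) / (x b - x a), (div_mul_cancel₀ _ hab'.ne').symm⟩
  obtain ⟨r, hr⟩ : ∃ r, y d - y c = r * (x d - x c) :=
    ⟨(y d - y c) / (x d - x c), (div_mul_cancel₀ _ hcd'.ne').symm⟩
  have l1 : ∀ w ∈ S, y w ≤ y b + s * (x w - x b) := fun w hw => by
    have := h1 w hw
    rw [hs] at this
    have : (x b - x a) * (y w - y b) ≤ (x b - x a) * (s * (x w - x b)) := by linarith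
    linarith [le_of_mul_le_mul_left this hab']
  have l2 : ∀ w ∈ S, y w ≤ y d + r * (x w - x d) := fun w hw => by
    have := h2 w hw
    rw [hr] at this
    have : (x d - x c) * (y w - y d) ≤ (x d - x c) * (r * (x w - x d)) := by linarith
    linarith [le_of_mul_le_mul_left this hcd']
  have ea := l2 a ha
  have eb := l2 b hb
  have ec := l1 c hc
  have ed := l1 d hd
  set D := (y d - r * x d) - (y b - s * x b) with hD
  have da : 0 ≤ D + (r - s) * x a := by linarith
  have db : 0 ≤ D + (r - s) * x b := by linarith
  have dc : D + (r - s) * x c ≤ 0 := by linarith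
  have dd : D + (r - s) * x d ≤ 0 := by linarith
  have hrs : r = s := by
    rcases lt_trichotomy r s with h | h | h
    · nlinarith [mul_pos (sub_pos.2 h) (sub_pos.2 htb), mul_pos (sub_pos.2 h) (sub_pos.2 hct)]
    · exact h
    · nlinarith [mul_pos (sub_pos.2 h) (sub_pos.2 htd), mul_pos (sub_pos.2 h) (sub_pos.2 hat)]
  subst hrs
  have hD0 : D = 0 := by
    apply le_antisymm <;> linarith
  have hne : a ≠ b := by rintro rfl; exact lt_irrefl _ hab
  have mem : ∀ w ∈ S, y w = y b + r * (x w - x b) → w = a ∨ w = b := by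
    intro w hw hyw
    by_contra! hcon
    refine hS a ha b hb w hw hne hcon.1.symm hcon.2.symm ?_
    have : y w - y a = r * (x w - x a) := by linarith
    rw [hs, this]
    ring
  rcases mem c hc (by linarith) with rfl | rfl <;> rcases mem d hd (by linarith) with rfl | rfl
  · exact absurd hcd (lt_irrefl _)
  · exact ⟨rfl, rfl⟩
  · exact absurd hcd hab.not_gt
  · exact absurd hcd (lt_irrefl _)

open Classical in
theorem sum_isUpperEdge_le (hS : ∀ u ∈ S, ∀ v ∈ S, ∀ w ∈ S, u ≠ v → u ≠ w → v ≠ w →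
      (x v - x u) * (y w - y u) ≠ (y v - y u) * (x w - x u))
    {A B : ℝ} (hA : ∀ w ∈ S, A ≤ x w) (hB : ∀ w ∈ S, x w ≤ B) :
    ∑ p ∈ S ×ˢ S, (if IsUpperEdge S x y p.1 p.2 then ENNReal.ofReal (x p.2 - x p.1) else 0) ≤
      ENNReal.ofReal (B - A) := by
  rw [← Finset.sum_filter]
  simp only [← Real.volume_Ioo]
  rw [← measure_biUnion_finset _ fun _ _ => measurableSet_Ioo]
  · apply measure_mono
    simp only [Set.iUnion_subset_iff, Finset.mem_filter, Finset.mem_product]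
    rintro p ⟨⟨h1, h2⟩, -⟩ t ht
    exact ⟨(hA _ h1).trans_lt ht.1, ht.2.trans_le (hB _ h2)⟩
  · rintro ⟨a, b⟩ hp ⟨c, d⟩ hq hne
    simp only [Finset.coe_filter, Finset.mem_product, Set.mem_ofPred_eq] at hp hq
    refine Set.disjoint_left.2 fun t ht1 ht2 => hne ?_
    obtain ⟨rfl, rfl⟩ := hp.2.eq_of_mem_Ioo hS hp.1.1 hp.1.2 hq.1.1 hq.1.2 hq.2 ht1 ht2
    rfl

end Planar

/-! ### Shadow vertices as strict maximizers, and their incoming edges. -/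

section Shadow

variable {n : ℕ}

theorem IsPolytope.exists_finset {P : Set (EuclideanSpace ℝ (Fin n))} (hP : IsPolytope P) :
    ∃ S : Finset (EuclideanSpace ℝ (Fin n)), (S : Set (EuclideanSpace ℝ (Fin n))) = vertices P ∧
      P = convexHull ℝ (S : Set (EuclideanSpace ℝ (Fin n))) := by
  obtain ⟨s, rfl⟩ := hP
  have hfin : (vertices (convexHull ℝ (s : Set (EuclideanSpace ℝ (Fin n))))).Finite :=
    s.finite_toSet.subset extremePoints_convexHull_subset
  refine ⟨hfin.toFinset, hfin.coe_toFinset, ?_⟩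
  rw [hfin.coe_toFinset, ← (hfin.isClosed_convexHull ℝ).closure_eq]
  exact (closure_convexHull_extremePoints (s.finite_toSet.isCompact_convexHull ℝ)
    (convex_convexHull ℝ _)).symm

/-- The condition `q ≠ p → l q < l p` defines a convex set, so it passes from `T` to its hull. -/
theorem mem_extremePoints_convexHull_of_lt {E : Type*} [AddCommGroup E] [Module ℝ E] {T : Set E}
    {p : E} (hp : p ∈ T) (l : E →ₗ[ℝ] ℝ) (h : ∀ q ∈ T, q ≠ p → l q < l p) :
    p ∈ (convexHull ℝ T).extremePoints ℝ := by
  have hH : Convex ℝ {q | q ≠ p → l q < l p} := by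
    intro y hy z hz a b ha hb hab hne
    by_cases hyp : y = p
    · by_cases hzp : z = p
      · refine absurd ?_ hne
        rw [hyp, hzp, ← add_smul, hab, one_smul]
      · have hb0 : b ≠ 0 := by
          rintro rfl
          refine hne ?_
          rw [hyp, zero_smul, add_zero, ← add_zero a, hab, one_smul]
        rw [map_add, map_smul, map_smul, hyp, smul_eq_mul, smul_eq_mul]
        have := mul_lt_mul_of_pos_left (hz hzp) (hb.lt_of_ne' hb0)
        calc a * l p + b * l z < a * l p + b * l p := by linarith
          _ = l p := by rw [← add_mul, hab, one_mul]
    · have hzl : l z ≤ l p := by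
        by_cases hzp : z = p
        · rw [hzp]
        · exact (hz hzp).le
      by_cases ha0 : a = 0
      · subst ha0
        rw [zero_add] at hab
        subst hab
        simp only [zero_smul, zero_add, one_smul] at hne ⊢
        exact hz hne
      · rw [map_add, map_smul, map_smul, smul_eq_mul, smul_eq_mul]
        have h1 := mul_lt_mul_of_pos_left (hy hyp) (ha.lt_of_ne' ha0)
        have h2 := mul_le_mul_of_nonneg_left hzl hb
        calc a * l y + b * l z < a * l p + b * l p := by linarith
          _ = l p := by rw [← add_mul, hab, one_mul]
  have hsub : convexHull ℝ T ⊆ {q | q ≠ p → l q < l p} := convexHull_min (fun q hq => h q hq) hH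
  rw [mem_extremePoints_iff_left]
  refine ⟨subset_convexHull ℝ T hp, fun y hy z hz hpyz => ?_⟩
  by_contra hne
  obtain ⟨a, b, ha, hb, hab, hp'⟩ := hpyz
  have h1 := mul_lt_mul_of_pos_left (hsub hy hne) ha
  have hzl : l z ≤ l p := by
    by_cases hzp : z = p
    · rw [hzp]
    · exact (hsub hz hzp).le
  have h2 := mul_le_mul_of_nonneg_left hzl hb.le
  have h3 := congrArg l hp'
  rw [map_add, map_smul, map_smul, smul_eq_mul, smul_eq_mul] at h3
  have h4 : a * l p + b * l p = l p := by rw [← add_mul, hab, one_mul]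
  linarith

/-- The projection `x ↦ (Uᵀx, Vᵀx)` as a linear map. -/
noncomputable def shadowMap (F : EuclideanSpace ℝ (Fin n) × EuclideanSpace ℝ (Fin n)) :
    EuclideanSpace ℝ (Fin n) →ₗ[ℝ] EuclideanSpace ℝ (Fin 2) where
  toFun x := !₂[inner ℝ F.1 x, inner ℝ F.2 x]
  map_add' x y := by ext i; fin_cases i <;> simp [inner_add_right]
  map_smul' c x := by ext i; fin_cases i <;> simp [inner_smul_right]

/-- The pairs `F` for which `v` is the unique maximizer on `S` of a linear functional in the span
of the two vectors. -/
def strictMaxSet (S : Finset (EuclideanSpace ℝ (Fin n))) (v : EuclideanSpace ℝ (Fin n)) :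
    Set (EuclideanSpace ℝ (Fin n) × EuclideanSpace ℝ (Fin n)) :=
  {F | ∃ c d : ℝ, ∀ w ∈ S, w ≠ v → inner ℝ (c • F.1 + d • F.2) (w - v) < 0}

theorem isOpen_strictMaxSet (S : Finset (EuclideanSpace ℝ (Fin n)))
    (v : EuclideanSpace ℝ (Fin n)) : IsOpen (strictMaxSet S v) := by
  have : strictMaxSet S v = ⋃ c : ℝ, ⋃ d : ℝ, ⋂ w ∈ S.filter (· ≠ v),
      {F | inner ℝ (c • F.1 + d • F.2) (w - v) < 0} := by
    ext F
    simp [strictMaxSet]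
  rw [this]
  exact isOpen_iUnion fun c => isOpen_iUnion fun d => isOpen_biInter_finset fun w _ =>
    isOpen_lt (by fun_prop) (by fun_prop)

/-- An extreme point is strictly separated from the hull of the other projected points by
Hahn–Banach, and the coordinates of the functional provide `c` and `d`. Injectivity of `⟨F.1, ·⟩` on
`S` keeps distinct points of `S` distinct in the shadow. -/
theorem vertices_shadow_convexHull (S : Finset (EuclideanSpace ℝ (Fin n)))
    {F : EuclideanSpace ℝ (Fin n) × EuclideanSpace ℝ (Fin n)}
    (hF : Set.InjOn (fun v => inner ℝ F.1 v) S) :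
    vertices (shadow (convexHull ℝ (S : Set (EuclideanSpace ℝ (Fin n)))) F) =
      shadowMap F '' {v | v ∈ S ∧ F ∈ strictMaxSet S v} := by
  have hinj : Set.InjOn (shadowMap F) S := fun u hu v hv h => hF hu hv (by
    simpa [shadowMap] using congrArg (fun z : EuclideanSpace ℝ (Fin 2) => z 0) h)
  have hsh : shadow (convexHull ℝ (S : Set (EuclideanSpace ℝ (Fin n)))) F =
      convexHull ℝ (shadowMap F '' S) := by
    rw [← LinearMap.image_convexHull]
    rfl
  have hfun : ∀ (z : EuclideanSpace ℝ (Fin 2)) (v w : EuclideanSpace ℝ (Fin n)),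
      inner ℝ z (shadowMap F w) - inner ℝ z (shadowMap F v) =
        inner ℝ (z 0 • F.1 + z 1 • F.2) (w - v) := by
    intro z v w
    rw [← inner_sub_right, ← map_sub, inner_add_left, inner_smul_left, inner_smul_left]
    simp [shadowMap, PiLp.inner_apply, mul_comm]
  rw [hsh, vertices]
  ext p
  constructor
  · intro hp
    obtain ⟨v, hv, rfl⟩ := extremePoints_convexHull_subset hp
    refine ⟨v, ⟨hv, ?_⟩, rfl⟩
    have hnot := (((convex_convexHull ℝ _).mem_extremePoints_iff_mem_sdiff_convexHull_sdiff).1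
      hp).2
    have hnot' : shadowMap F v ∉ convexHull ℝ (shadowMap F '' S \ {shadowMap F v}) := fun h =>
      hnot (convexHull_mono (Set.sdiff_subset_sdiff_left (subset_convexHull ℝ _)) h)
    obtain ⟨f, t, hf1, hf2⟩ := geometric_hahn_banach_closed_point (convex_convexHull ℝ _)
      (((S.finite_toSet.image (shadowMap F)).subset Set.sdiff_subset).isClosed_convexHull ℝ) hnot'
    set z := (InnerProductSpace.toDual ℝ (EuclideanSpace ℝ (Fin 2))).symm f with hz
    have hzf : ∀ q, inner ℝ z q = f q := fun q => InnerProductSpace.toDual_symm_apply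
    refine ⟨z 0, z 1, fun w hw hwv => ?_⟩
    rw [← hfun, hzf, hzf]
    have := hf1 (shadowMap F w) (subset_convexHull ℝ _
      ⟨⟨w, hw, rfl⟩, fun h => hwv (hinj hw hv h)⟩)
    linarith
  · rintro ⟨v, ⟨hv, c, d, hcd⟩, rfl⟩
    refine mem_extremePoints_convexHull_of_lt ⟨v, hv, rfl⟩
      (innerSL ℝ (!₂[c, d] : EuclideanSpace ℝ (Fin 2))).toLinearMap ?_
    rintro _ ⟨w, hw, rfl⟩ hne
    have h1 := hcd w hw (by rintro rfl; exact hne rfl)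
    have h2 := hfun !₂[c, d] v w
    simp only [ContinuousLinearMap.coe_coe, innerSL_apply_apply]
    simp only [Matrix.cons_val_zero, Matrix.cons_val_one] at h2
    linarith

open Classical in
theorem shadowSize_convexHull (S : Finset (EuclideanSpace ℝ (Fin n)))
    {F : EuclideanSpace ℝ (Fin n) × EuclideanSpace ℝ (Fin n)}
    (hF : Set.InjOn (fun v => inner ℝ F.1 v) S) :
    shadowSize (convexHull ℝ (S : Set (EuclideanSpace ℝ (Fin n)))) F =
      ∑ v ∈ S, if F ∈ strictMaxSet S v then 1 else 0 := by
  have hinj : Set.InjOn (shadowMap F) {v | v ∈ S ∧ F ∈ strictMaxSet S v} :=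
    fun u hu v hv h => hF hu.1 hv.1 (by
      simpa [shadowMap] using congrArg (fun z : EuclideanSpace ℝ (Fin 2) => z 0) h)
  rw [shadowSize, vertices_shadow_convexHull S hF, hinj.ncard_image,
    Finset.sum_boole, ← Set.ncard_coe_finset]
  simp

/-- The orthonormalized pair lies in the span of `G`; this one inclusion suffices for an upper
bound. -/
theorem mem_strictMaxSet_of_orthonormalize {S : Finset (EuclideanSpace ℝ (Fin n))}
    {v : EuclideanSpace ℝ (Fin n)} {G : EuclideanSpace ℝ (Fin n) × EuclideanSpace ℝ (Fin n)}
    (h : orthonormalize G ∈ strictMaxSet S v) : G ∈ strictMaxSet S v := by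
  obtain ⟨c, d, h⟩ := h
  simp only [orthonormalize] at h
  set u := inner ℝ (‖G.1‖⁻¹ • G.1) G.2
  set r := ‖G.2 - u • ‖G.1‖⁻¹ • G.1‖⁻¹
  refine ⟨c * ‖G.1‖⁻¹ - d * r * u * ‖G.1‖⁻¹, d * r, fun w hw hwv => ?_⟩
  convert! h w hw hwv using 2
  module

/-- The polar cone of `S - v`. -/
def normalCone (S : Finset (EuclideanSpace ℝ (Fin n))) (v : EuclideanSpace ℝ (Fin n)) :
    Set (EuclideanSpace ℝ (Fin n)) :=
  {z | ∀ w ∈ S, inner ℝ z (w - v) ≤ 0}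

theorem measurableSet_normalCone (S : Finset (EuclideanSpace ℝ (Fin n)))
    (v : EuclideanSpace ℝ (Fin n)) : MeasurableSet (normalCone S v) := by
  have : normalCone S v = ⋂ w ∈ S, {z | inner ℝ z (w - v) ≤ 0} := by
    ext z
    simp [normalCone]
  rw [this]
  exact Finset.measurableSet_biInter _ fun w _ =>
    (isClosed_le (by fun_prop) (by fun_prop)).measurableSet

theorem smul_mem_normalCone_iff (S : Finset (EuclideanSpace ℝ (Fin n)))
    (v : EuclideanSpace ℝ (Fin n)) (r : ℝ) (hr : 0 < r) (z : EuclideanSpace ℝ (Fin n)) :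
    r • z ∈ normalCone S v ↔ z ∈ normalCone S v := by
  simp only [normalCone, Set.mem_ofPred_eq, real_inner_smul_left]
  congr! 2 with w hw
  exact ⟨fun h => nonpos_of_mul_nonpos_right h hr,
    fun h => mul_nonpos_of_nonneg_of_nonpos hr.le h⟩

theorem mem_normalEvent_iff {S : Finset (EuclideanSpace ℝ (Fin n))}
    {u v g h : EuclideanSpace ℝ (Fin n)} :
    (g, h) ∈ normalEvent (v - u) (normalCone S v) ↔
      IsUpperEdge S (fun w => inner ℝ g w) (fun w => inner ℝ h w) u v := by
  simp only [normalEvent, normalCone, IsUpperEdge, Set.mem_ofPred_eq, inner_sub_right,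
    inner_sub_left, real_inner_smul_left]
  refine and_congr sub_pos (forall₂_congr fun w _ => ?_)
  constructor <;> intro h <;> linarith

open Classical in
theorem sum_strictMaxSet_le {S : Finset (EuclideanSpace ℝ (Fin n))}
    {g h : EuclideanSpace ℝ (Fin n)} (hg : Set.InjOn (fun v => inner ℝ g v) S) :
    (∑ v ∈ S, if (g, h) ∈ strictMaxSet S v then 1 else 0 : ℝ≥0∞) ≤
      1 + ((∑ p ∈ S ×ˢ S, if (g, h) ∈ normalEvent (p.2 - p.1) (normalCone S p.2) then 1 else 0) +
        ∑ p ∈ S ×ˢ S, if (g, -h) ∈ normalEvent (p.2 - p.1) (normalCone S p.2) then 1 else 0) := by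
  have hleft : (∑ v ∈ S, if ∀ u ∈ S, inner ℝ g v ≤ inner ℝ g u then 1 else 0 : ℝ≥0∞) ≤ 1 := by
    rw [Finset.sum_boole]
    norm_cast
    rw [Finset.card_le_one]
    intro a ha b hb
    rw [Finset.mem_filter] at ha hb
    exact hg ha.1 hb.1 (le_antisymm (ha.2 b hb.1) (hb.2 a ha.1))
  refine le_trans ?_ (add_le_add_left hleft _)
  rw [Finset.sum_product_right, Finset.sum_product_right, ← Finset.sum_add_distrib,
    ← Finset.sum_add_distrib]
  refine Finset.sum_le_sum fun v hv => ?_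
  split_ifs with h1 h2
  · exact le_self_add
  · push Not at h2
    obtain ⟨u, hu, huv⟩ := h2
    obtain ⟨c, d, hcd⟩ := h1
    rw [zero_add]
    -- The sign of `d` decides whether `v` is charged to an upper edge or, after reflecting `h`, to
    -- a lower one.
    rcases le_total 0 d with hd | hd
    · obtain ⟨a, ha, hav⟩ := exists_isUpperEdge (y := fun w => inner ℝ h w) (c := c) (d := d) hg hv
        hu huv hd fun w hw hwv => by
          have := hcd w hw hwv
          simp only [inner_add_left, real_inner_smul_left, inner_sub_right] at this ⊢
          linarith
      rw [← mem_normalEvent_iff] at hav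
      refine le_trans ?_ le_self_add
      refine le_trans ?_ (Finset.single_le_sum (fun _ _ => zero_le) ha)
      rw [if_pos hav]
    · obtain ⟨a, ha, hav⟩ := exists_isUpperEdge (y := fun w => inner ℝ (-h) w) (c := c) (d := -d)
        hg hv hu huv (neg_nonneg.2 hd) fun w hw hwv => by
          have := hcd w hw hwv
          simp only [inner_add_left, real_inner_smul_left, inner_sub_right, inner_neg_left] at this ⊢
          linarith
      rw [← mem_normalEvent_iff] at hav
      refine le_trans ?_ le_add_self
      refine le_trans ?_ (Finset.single_le_sum (fun _ _ => zero_le) ha)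
      rw [if_pos hav]
  · exact zero_le
  · exact zero_le

end Shadow

/-! ### General position almost surely, and the expected number of edges. -/

section Expectation

variable {n : ℕ}

/-- The position of `c` relative to `0` and `1` tells which of the three points would lie between
the other two. -/
theorem not_collinear_of_mem_extremePoints {E : Type*} [AddCommGroup E] [Module ℝ E] {P : Set E}
    {u v w : E} (hu : u ∈ P.extremePoints ℝ) (hv : v ∈ P.extremePoints ℝ)
    (hw : w ∈ P.extremePoints ℝ) (huv : u ≠ v) (huw : u ≠ w) (hvw : v ≠ w) (c : ℝ) :
    w - u ≠ c • (v - u) := by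
  intro h
  have hw' : w = (1 - c) • u + c • v := by
    rw [sub_eq_iff_eq_add] at h
    rw [h]
    module
  rcases lt_trichotomy c 0 with hc | rfl | hc
  · have hc1 : (0 : ℝ) < 1 - c := by linarith
    refine huw (mem_extremePoints_iff_left.1 hu |>.2 w hw.1 v hv.1
      ⟨(1 - c)⁻¹, -c * (1 - c)⁻¹, inv_pos.2 hc1, mul_pos (neg_pos.2 hc) (inv_pos.2 hc1), ?_, ?_⟩).symm
    · field_simp
      ring
    · rw [hw', smul_add, smul_smul, smul_smul, inv_mul_cancel₀ hc1.ne']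
      module
  · exact huw (by simpa using hw'.symm)
  rcases lt_trichotomy c 1 with hc1 | rfl | hc1
  · refine huw (mem_extremePoints_iff_left.1 hw |>.2 u hu.1 v hv.1
      ⟨1 - c, c, by linarith, hc, by ring, hw'.symm⟩)
  · exact hvw (by simpa using hw'.symm)
  · refine huv (mem_extremePoints_iff_left.1 hv |>.2 u hu.1 w hw.1
      ⟨(c - 1) * c⁻¹, c⁻¹, mul_pos (by linarith) (inv_pos.2 hc), inv_pos.2 hc, ?_, ?_⟩)
    · field_simp
      ring
    · rw [hw', smul_add, smul_smul, smul_smul, inv_mul_cancel₀ hc.ne']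
      module

theorem ae_injOn_inner (S : Finset (EuclideanSpace ℝ (Fin n))) :
    ∀ᵐ g ∂(stdGaussian (EuclideanSpace ℝ (Fin n))), Set.InjOn (fun v => inner ℝ g v) S := by
  have h : ∀ᵐ g ∂(stdGaussian (EuclideanSpace ℝ (Fin n))), ∀ u ∈ S, ∀ v ∈ S, u ≠ v →
      inner ℝ g u ≠ inner ℝ g v := by
    refine (Filter.eventually_all_finset S).2 fun u _ =>
      (Filter.eventually_all_finset S).2 fun v _ => ?_
    by_cases huv : u = v
    · simp [huv]
    filter_upwards [measure_eq_zero_iff_ae_notMem.1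
      (stdGaussian_hyperplane (u - v) (sub_ne_zero.2 huv))] with g hg _ h
    apply hg
    rw [real_inner_comm, inner_sub_right, h, sub_self]
  filter_upwards [h] with g hg u hu v hv huv
  by_contra hne
  exact hg u hu v hv hne huv

theorem ae_not_collinear {S : Finset (EuclideanSpace ℝ (Fin n))}
    (hS : ∀ u ∈ S, ∀ v ∈ S, ∀ w ∈ S, u ≠ v → u ≠ w → v ≠ w → ∀ c : ℝ, w - u ≠ c • (v - u)) :
    ∀ᵐ p ∂((stdGaussian (EuclideanSpace ℝ (Fin n))).prod
        (stdGaussian (EuclideanSpace ℝ (Fin n)))),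
      ∀ u ∈ S, ∀ v ∈ S, ∀ w ∈ S, u ≠ v → u ≠ w → v ≠ w →
        (inner ℝ p.1 v - inner ℝ p.1 u) * (inner ℝ p.2 w - inner ℝ p.2 u) ≠
          (inner ℝ p.2 v - inner ℝ p.2 u) * (inner ℝ p.1 w - inner ℝ p.1 u) := by
  refine (Filter.eventually_all_finset S).2 fun u hu =>
    (Filter.eventually_all_finset S).2 fun v hv =>
    (Filter.eventually_all_finset S).2 fun w hw => ?_
  by_cases huv : u = v
  · simp [huv]
  by_cases huw : u = w
  · simp [huw]
  by_cases hvw : v = w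
  · simp [hvw]
  simp only [ne_eq, huv, huw, hvw, not_false_eq_true, forall_const]
  refine (Measure.ae_prod_iff_ae_ae (p := fun q =>
    ¬(inner ℝ q.1 v - inner ℝ q.1 u) * (inner ℝ q.2 w - inner ℝ q.2 u) =
      (inner ℝ q.2 v - inner ℝ q.2 u) * (inner ℝ q.1 w - inner ℝ q.1 u))
    (measurableSet_eq_fun (by fun_prop) (by fun_prop)).compl).2 ?_
  filter_upwards [measure_eq_zero_iff_ae_notMem.1
    (stdGaussian_hyperplane (v - u) (sub_ne_zero.2 (Ne.symm huv)))] with g hg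
  have hg' : inner ℝ g (v - u) ≠ 0 := fun h => hg (by rwa [real_inner_comm] at h)
  -- For fixed `g`, projected collinearity says that `h` is orthogonal to this nonzero vector, a
  -- null event.
  have hz : inner ℝ g (v - u) • (w - u) - inner ℝ g (w - u) • (v - u) ≠ 0 := by
    intro h
    refine hS u hu v hv w hw huv huw hvw ((inner ℝ g (v - u))⁻¹ * inner ℝ g (w - u)) ?_
    rw [mul_smul, ← sub_eq_zero.1 h, smul_smul, inv_mul_cancel₀ hg', one_smul]
  filter_upwards [measure_eq_zero_iff_ae_notMem.1 (stdGaussian_hyperplane _ hz)] with h hh heq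
  apply hh
  rw [real_inner_comm, inner_sub_right, real_inner_smul_right, real_inner_smul_right]
  simp only [inner_sub_right]
  linarith

theorem abs_inner_le_mul_sum {α : ℝ} {v : EuclideanSpace ℝ (Fin n)} (hv : ∀ i, |v i| ≤ α)
    (g : EuclideanSpace ℝ (Fin n)) : |inner ℝ g v| ≤ α * ∑ i, |g i| := by
  rw [PiLp.inner_apply, Finset.mul_sum]
  refine (Finset.abs_sum_le_sum_abs _ _).trans (Finset.sum_le_sum fun i _ => ?_)
  simp only [RCLike.inner_apply, conj_trivial, abs_mul]
  exact mul_le_mul_of_nonneg_right (hv i) (abs_nonneg _)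

theorem normalEvent_zero {E : Type*} [NormedAddCommGroup E] [InnerProductSpace ℝ E] (K : Set E) :
    normalEvent 0 K = ∅ := by
  ext p
  simp [normalEvent]

theorem sum_measure_normalEvent_mul_le {S : Finset (EuclideanSpace ℝ (Fin n))}
    (hS : ∀ u ∈ S, ∀ v ∈ S, ∀ w ∈ S, u ≠ v → u ≠ w → v ≠ w → ∀ c : ℝ, w - u ≠ c • (v - u))
    {α δ : ℝ} (hα : ∀ v ∈ S, ∀ i, |v i| ≤ α) (hα0 : 0 ≤ α)
    (hδ : ∀ u ∈ S, ∀ v ∈ S, u ≠ v → δ ≤ ‖v - u‖) :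
    (∑ p ∈ S ×ˢ S, ((stdGaussian (EuclideanSpace ℝ (Fin n))).prod
        (stdGaussian (EuclideanSpace ℝ (Fin n)))) (normalEvent (p.2 - p.1) (normalCone S p.2))) *
      (ENNReal.ofReal δ * gaussianPosPart) ≤ ENNReal.ofReal (2 * α) * (n * gaussianAbs) := by
  classical
  set μ := (stdGaussian (EuclideanSpace ℝ (Fin n))).prod (stdGaussian (EuclideanSpace ℝ (Fin n)))
  have hm : ∀ p : EuclideanSpace ℝ (Fin n) × EuclideanSpace ℝ (Fin n),
      MeasurableSet (normalEvent (p.2 - p.1) (normalCone S p.2)) := fun p =>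
    measurableSet_normalEvent _ (measurableSet_normalCone S p.2)
  calc _ ≤ ∑ p ∈ S ×ˢ S, ∫⁻ q, (normalEvent (p.2 - p.1) (normalCone S p.2)).indicator
          (fun q => ENNReal.ofReal (inner ℝ q.1 (p.2 - p.1))) q ∂μ := by
        rw [Finset.sum_mul]
        refine Finset.sum_le_sum fun p hp => ?_
        rw [Finset.mem_product] at hp
        by_cases h : p.1 = p.2
        -- Diagonal pairs give the empty event, so they need no lower bound on length.
        · simp [h, normalEvent_zero]
        · refine le_trans ?_ (measure_normalEvent_mul_le (sub_ne_zero.2 (Ne.symm h))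
            (measurableSet_normalCone S p.2) (smul_mem_normalCone_iff S p.2))
          gcongr
          exact hδ _ hp.1 _ hp.2 h
    _ = ∫⁻ q, ∑ p ∈ S ×ˢ S, (normalEvent (p.2 - p.1) (normalCone S p.2)).indicator
          (fun q => ENNReal.ofReal (inner ℝ q.1 (p.2 - p.1))) q ∂μ :=
        (lintegral_finsetSum _ fun p _ => (by fun_prop :
          Measurable fun q : EuclideanSpace ℝ (Fin n) × EuclideanSpace ℝ (Fin n) =>
            ENNReal.ofReal (inner ℝ q.1 (p.2 - p.1))).indicator (hm p)).symm
    _ ≤ ∫⁻ q, ENNReal.ofReal (2 * α) * ∑ i, ENNReal.ofReal |q.1 i| ∂μ := by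
        refine lintegral_mono_ae ?_
        filter_upwards [ae_not_collinear hS] with q hq
        have hb : ∀ w ∈ S, |inner ℝ q.1 w| ≤ α * ∑ i, |q.1 i| := fun w hw =>
          abs_inner_le_mul_sum (hα w hw) q.1
        have := sum_isUpperEdge_le (x := fun w => inner ℝ q.1 w) (y := fun w => inner ℝ q.2 w)
          hq (fun w hw => (abs_le.1 (hb w hw)).1) (fun w hw => (abs_le.1 (hb w hw)).2)
        calc _ ≤ _ := le_of_eq (Finset.sum_congr rfl fun p _ => by
                rw [Set.indicator_apply, inner_sub_right]
                exact if_congr mem_normalEvent_iff rfl rfl)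
          _ ≤ _ := this
          _ = _ := by
            rw [← ENNReal.ofReal_sum_of_nonneg fun _ _ => abs_nonneg _,
              ← ENNReal.ofReal_mul (by positivity)]
            congr 1
            ring
    _ = _ := by
        rw [lintegral_const_mul _ (by fun_prop), lintegral_finsetSum _ (by fun_prop)]
        congr 1
        have : ∀ i : Fin n, ∫⁻ q, ENNReal.ofReal |q.1 i| ∂μ = gaussianAbs := by
          intro i
          rw [← lintegral_abs_apply_stdGaussian i, lintegral_prod _ (by fun_prop)]
          simp
        simp [this]

theorem ae_uniformFrame_injOn (S : Finset (EuclideanSpace ℝ (Fin n))) :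
    ∀ᵐ F ∂(uniformFrame n), Set.InjOn (fun v => inner ℝ F.1 v) S := by
  have hms : MeasurableSet {F : EuclideanSpace ℝ (Fin n) × EuclideanSpace ℝ (Fin n) |
      Set.InjOn (fun v => inner ℝ F.1 v) S} := by
    have : {F : EuclideanSpace ℝ (Fin n) × EuclideanSpace ℝ (Fin n) |
        Set.InjOn (fun v => inner ℝ F.1 v) S} =
        ⋂ u ∈ S, ⋂ v ∈ S.filter (u ≠ ·), {F | inner ℝ F.1 u = inner ℝ F.1 v}ᶜ := by
      ext F
      simp only [Set.InjOn, Set.mem_ofPred_eq, Set.mem_iInter, Finset.mem_filter,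
        Set.mem_compl_iff, SetLike.mem_coe]
      exact ⟨fun h u hu v hv hE => hv.2 (h hu hv.1 hE), fun h u hu v hv hE => by
        by_contra hne
        exact h u hu v ⟨hv, hne⟩ hE⟩
    rw [this]
    exact Finset.measurableSet_biInter _ fun u _ => Finset.measurableSet_biInter _ fun v _ =>
      (measurableSet_eq_fun (by fun_prop) (by fun_prop)).compl
  rw [uniformFrame, ae_map_iff measurable_orthonormalize.aemeasurable hms]
  filter_upwards [Measure.quasiMeasurePreserving_fst.ae (ae_injOn_inner S)] with G hG u hu v hv huv
  by_cases h0 : G.1 = 0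
  · exact hG hu hv (by simp [h0])
  · refine hG hu hv ?_
    simp only [orthonormalize, real_inner_smul_left] at huv
    exact mul_left_cancel₀ (inv_ne_zero (norm_ne_zero_iff.2 h0)) huv

theorem lintegral_shadowSize_le (S : Finset (EuclideanSpace ℝ (Fin n))) :
    ∫⁻ F, (shadowSize (convexHull ℝ (S : Set (EuclideanSpace ℝ (Fin n)))) F : ℝ≥0∞)
        ∂(uniformFrame n) ≤
      1 + 2 * ∑ p ∈ S ×ˢ S, ((stdGaussian (EuclideanSpace ℝ (Fin n))).prod
        (stdGaussian (EuclideanSpace ℝ (Fin n)))) (normalEvent (p.2 - p.1) (normalCone S p.2)) := by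
  classical
  set μ := (stdGaussian (EuclideanSpace ℝ (Fin n))).prod (stdGaussian (EuclideanSpace ℝ (Fin n)))
    with hμ
  have hm : ∀ p : EuclideanSpace ℝ (Fin n) × EuclideanSpace ℝ (Fin n),
      MeasurableSet (normalEvent (p.2 - p.1) (normalCone S p.2)) := fun p =>
    measurableSet_normalEvent _ (measurableSet_normalCone S p.2)
  have hN : Measurable fun G : EuclideanSpace ℝ (Fin n) × EuclideanSpace ℝ (Fin n) =>
      (G.1, -G.2) := by fun_prop
  have hneg : μ.map (fun G => (G.1, -G.2)) = μ := by
    have h1 := Measure.map_prod_map (stdGaussian (EuclideanSpace ℝ (Fin n)))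
      (stdGaussian (EuclideanSpace ℝ (Fin n))) measurable_id measurable_neg
    have h2 : (stdGaussian (EuclideanSpace ℝ (Fin n))).map (fun x => -x) =
        stdGaussian (EuclideanSpace ℝ (Fin n)) :=
      stdGaussian_map (LinearIsometryEquiv.neg ℝ)
    rw [Measure.map_id, h2] at h1
    exact h1.symm
  have hO : ∀ v, MeasurableSet (strictMaxSet S v) := fun v =>
    (isOpen_strictMaxSet S v).measurableSet
  have hmeas : Measurable fun F : EuclideanSpace ℝ (Fin n) × EuclideanSpace ℝ (Fin n) =>
      (∑ v ∈ S, if F ∈ strictMaxSet S v then 1 else 0 : ℝ≥0∞) :=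
    Finset.measurable_sum _ fun v _ => Measurable.ite (hO v) measurable_const measurable_const
  have hm1 : ∀ p : EuclideanSpace ℝ (Fin n) × EuclideanSpace ℝ (Fin n),
      Measurable fun G : EuclideanSpace ℝ (Fin n) × EuclideanSpace ℝ (Fin n) =>
        (if G ∈ normalEvent (p.2 - p.1) (normalCone S p.2) then 1 else 0 : ℝ≥0∞) := fun p =>
    Measurable.ite (hm p) measurable_const measurable_const
  have hint : ∀ p : EuclideanSpace ℝ (Fin n) × EuclideanSpace ℝ (Fin n),
      ∫⁻ G, (if G ∈ normalEvent (p.2 - p.1) (normalCone S p.2) then 1 else 0 : ℝ≥0∞) ∂μ =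
        μ (normalEvent (p.2 - p.1) (normalCone S p.2)) := fun p => by
    rw [← lintegral_indicator_one (hm p)]
    rfl
  have hint' : ∀ p : EuclideanSpace ℝ (Fin n) × EuclideanSpace ℝ (Fin n),
      ∫⁻ G, (if (G.1, -G.2) ∈ normalEvent (p.2 - p.1) (normalCone S p.2) then 1 else 0 : ℝ≥0∞) ∂μ =
        μ (normalEvent (p.2 - p.1) (normalCone S p.2)) := fun p => by
    rw [← hint p]
    conv_rhs => rw [← hneg]
    rw [lintegral_map (hm1 p) hN]
  calc _ = ∫⁻ F, (∑ v ∈ S, if F ∈ strictMaxSet S v then 1 else 0 : ℝ≥0∞) ∂(uniformFrame n) := by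
        refine lintegral_congr_ae ?_
        filter_upwards [ae_uniformFrame_injOn S] with F hF
        rw [shadowSize_convexHull S hF]
        push_cast
        rfl
    _ = ∫⁻ G, (∑ v ∈ S, if orthonormalize G ∈ strictMaxSet S v then 1 else 0 : ℝ≥0∞) ∂μ := by
        rw [uniformFrame, lintegral_map hmeas measurable_orthonormalize]
    _ ≤ ∫⁻ G, (1 + ((∑ p ∈ S ×ˢ S,
            if (G.1, G.2) ∈ normalEvent (p.2 - p.1) (normalCone S p.2) then 1 else 0) +
          ∑ p ∈ S ×ˢ S,
            if (G.1, -G.2) ∈ normalEvent (p.2 - p.1) (normalCone S p.2) then 1 else 0)) ∂μ := by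
        refine lintegral_mono_ae ?_
        filter_upwards [Measure.quasiMeasurePreserving_fst.ae (ae_injOn_inner S)] with G hG
        refine le_trans (Finset.sum_le_sum fun v _ => ?_) (sum_strictMaxSet_le hG)
        split_ifs with h1 h2
        · exact le_rfl
        · exact absurd (mem_strictMaxSet_of_orthonormalize h1) h2
        · exact zero_le
        · exact le_rfl
    _ = _ := by
        rw [lintegral_add_left measurable_const, lintegral_add_left, lintegral_finsetSum,
          lintegral_finsetSum]
        · simp only [hint, hint', two_mul, lintegral_const, measure_univ, mul_one]
        · exact fun p _ => (hm1 p).comp hN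
        · exact fun p _ => hm1 p
        · exact Finset.measurable_sum _ fun p _ => hm1 p

theorem aemeasurable_shadowSize (S : Finset (EuclideanSpace ℝ (Fin n))) :
    AEMeasurable (fun F => (shadowSize (convexHull ℝ (S : Set (EuclideanSpace ℝ (Fin n)))) F : ℝ))
      (uniformFrame n) := by
  classical
  refine ⟨fun F => ∑ v ∈ S, if F ∈ strictMaxSet S v then 1 else 0,
    Finset.measurable_sum _ fun v _ => Measurable.ite
      (isOpen_strictMaxSet S v).measurableSet measurable_const measurable_const, ?_⟩
  filter_upwards [ae_uniformFrame_injOn S] with F hF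
  rw [shadowSize_convexHull S hF]
  push_cast
  rfl

theorem inv_sq_le_abs_sub {β x y : ℝ} (hx : ∃ p q : ℤ, 1 ≤ q ∧ (q : ℝ) ≤ β ∧ x = p / q)
    (hy : ∃ p q : ℤ, 1 ≤ q ∧ (q : ℝ) ≤ β ∧ y = p / q) (hne : x ≠ y) : (β ^ 2)⁻¹ ≤ |x - y| := by
  obtain ⟨p, q, hq, hqβ, rfl⟩ := hx
  obtain ⟨p', q', hq', hqβ', rfl⟩ := hy
  have h1 : (1 : ℝ) ≤ q := by exact_mod_cast hq
  have h1' : (1 : ℝ) ≤ q' := by exact_mod_cast hq'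
  have hq0 : (0 : ℝ) < q := by linarith
  have hq0' : (0 : ℝ) < q' := by linarith
  rw [div_sub_div _ _ hq0.ne' hq0'.ne', abs_div, abs_of_pos (mul_pos hq0 hq0')]
  have hnum : (1 : ℝ) ≤ |(p : ℝ) * q' - q * p'| := by
    have : p * q' - q * p' ≠ 0 := by
      intro h
      apply hne
      rw [div_eq_div_iff hq0.ne' hq0'.ne']
      have : (p : ℝ) * q' - q * p' = 0 := by exact_mod_cast h
      linarith
    exact_mod_cast Int.one_le_abs this
  rw [inv_eq_one_div]
  refine div_le_div₀ (by linarith) hnum (mul_pos hq0 hq0') ?_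
  rw [sq]
  exact mul_le_mul hqβ hqβ' hq0'.le (by linarith)

end Expectation

end RandomShadow

/-! ### Assembling the bound. -/

theorem mainTheorem7 :
    ∃ C : ℝ, 0 < C ∧
      ∀ (n : ℕ) (_ : 2 ≤ n) (P : Set (EuclideanSpace ℝ (Fin n))) (_ : RandomShadow.IsPolytope P)
        (α β : ℝ) (_ : 1 ≤ α)
        (_ : ∀ v ∈ RandomShadow.vertices P, ∀ i : Fin n,
          ∃ p q : ℤ, |(p : ℝ)| ≤ α ∧ 1 ≤ q ∧ (q : ℝ) ≤ β ∧ v i = (p : ℝ) / (q : ℝ)),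
        Integrable (fun F => (RandomShadow.shadowSize P F : ℝ)) (RandomShadow.uniformFrame n) ∧
        ∫ F, (RandomShadow.shadowSize P F : ℝ) ∂(RandomShadow.uniformFrame n)
          ≤ C * ((n : ℝ) * β ^ 2 * α) := by
  open RandomShadow in
  have hc0 : 0 < gaussianPosPart.toReal :=
    ENNReal.toReal_pos gaussianPosPart_ne_zero gaussianPosPart_ne_top
  -- The `1` pays for the leftmost vertex; `4` is `2` for upper and lower edges times `2` from the
  -- width `2α`.
  refine ⟨1 + 4 * (gaussianAbs.toReal / gaussianPosPart.toReal), by positivity, ?_⟩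
  intro n hn P hP α β hα hv
  obtain ⟨S, hSv, rfl⟩ := hP.exists_finset
  rw [← hSv] at hv
  set μ := (stdGaussian (EuclideanSpace ℝ (Fin n))).prod (stdGaussian (EuclideanSpace ℝ (Fin n)))
    with hμ
  set R := ∑ p ∈ S ×ˢ S, μ (normalEvent (p.2 - p.1) (normalCone S p.2)) with hR
  have hRtop : R ≠ ∞ := ENNReal.sum_ne_top.2 fun _ _ => measure_ne_top _ _
  have hle := lintegral_shadowSize_le S
  rw [← hμ, ← hR] at hle
  have hof : ∀ F, ENNReal.ofReal (shadowSize (convexHull ℝ (S : Set (EuclideanSpace ℝ (Fin n)))) F)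
      = (shadowSize (convexHull ℝ (S : Set (EuclideanSpace ℝ (Fin n)))) F : ℝ≥0∞) := fun F =>
    ENNReal.ofReal_natCast _
  have htop : 1 + 2 * R ≠ ∞ := by finiteness
  have hasm := (aemeasurable_shadowSize S).aestronglyMeasurable
  constructor
  · refine ⟨hasm, ?_⟩
    rw [hasFiniteIntegral_iff_ofReal (Filter.Eventually.of_forall fun F => Nat.cast_nonneg _)]
    simp only [hof]
    exact hle.trans_lt htop.lt_top
  rw [integral_eq_lintegral_of_nonneg_ae (Filter.Eventually.of_forall fun F => Nat.cast_nonneg _)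
    hasm]
  simp only [hof]
  -- Only a vertex forces `β ≥ 1`; for the empty polytope `β` is arbitrary, but `β ^ 2` keeps the
  -- right side nonnegative.
  rcases S.eq_empty_or_nonempty with rfl | ⟨v₀, hv₀⟩
  · have h0 : ∀ F, shadowSize (convexHull ℝ ((∅ : Finset (EuclideanSpace ℝ (Fin n))) :
        Set (EuclideanSpace ℝ (Fin n)))) F = 0 := fun F => by
      simp [shadowSize, shadow, vertices]
    simp only [h0, Nat.cast_zero, lintegral_zero, ENNReal.toReal_zero]
    positivity
  have hβ : 1 ≤ β := by
    obtain ⟨p, q, -, hq, hqβ, -⟩ := hv v₀ hv₀ ⟨0, by omega⟩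
    exact le_trans (by exact_mod_cast hq) hqβ
  have hbound : ∀ v ∈ S, ∀ i, |v i| ≤ α := by
    intro v hvS i
    obtain ⟨p, q, hp, hq, -, h⟩ := hv v hvS i
    have hq1 : (1 : ℝ) ≤ q := by exact_mod_cast hq
    rw [h, abs_div, abs_of_pos (by linarith : (0 : ℝ) < q)]
    exact (div_le_self (abs_nonneg _) hq1).trans hp
  have hδ : ∀ u ∈ S, ∀ v ∈ S, u ≠ v → (β ^ 2)⁻¹ ≤ ‖v - u‖ := by
    intro u hu v hvS huv
    obtain ⟨i, hi⟩ : ∃ i, v i ≠ u i := by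
      by_contra! h
      exact huv (by ext i; exact (h i).symm)
    refine le_trans ?_ (PiLp.norm_apply_le (v - u) i)
    obtain ⟨p, q, -, h1⟩ := hv v hvS i
    obtain ⟨p', q', -, h2⟩ := hv u hu i
    exact inv_sq_le_abs_sub ⟨p, q, h1⟩ ⟨p', q', h2⟩ hi
  have hmem : ∀ u ∈ S, u ∈ (convexHull ℝ (S : Set (EuclideanSpace ℝ (Fin n)))).extremePoints ℝ :=
    fun u hu => by
      change u ∈ vertices _
      rw [← hSv]
      exact hu
  have hsum := sum_measure_normalEvent_mul_le (S := S)
    (fun u hu v hv w hw h1 h2 h3 =>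
      not_collinear_of_mem_extremePoints (hmem u hu) (hmem v hv) (hmem w hw) h1 h2 h3)
    hbound (by linarith) hδ
  rw [← hμ, ← hR] at hsum
  have hsum' := ENNReal.toReal_mono (by have := gaussianAbs_ne_top; finiteness) hsum
  simp only [ENNReal.toReal_mul, ENNReal.toReal_natCast,
    ENNReal.toReal_ofReal (by positivity : (0 : ℝ) ≤ 2 * α),
    ENNReal.toReal_ofReal (by positivity : (0 : ℝ) ≤ (β ^ 2)⁻¹)] at hsum'
  have hRle : R.toReal ≤ 2 * (gaussianAbs.toReal / gaussianPosPart.toReal) * (n * β ^ 2 * α) := by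
    rw [← le_div_iff₀ (by positivity)] at hsum'
    refine hsum'.trans (le_of_eq ?_)
    field_simp
  have h1 : (1 : ℝ) ≤ n * β ^ 2 * α := by
    have : (1 : ℝ) ≤ n := by exact_mod_cast (by omega : 1 ≤ n)
    exact one_le_mul_of_one_le_of_one_le
      (one_le_mul_of_one_le_of_one_le this (one_le_pow₀ hβ)) hα
  have hfin := ENNReal.toReal_mono htop hle
  rw [ENNReal.toReal_add ENNReal.one_ne_top (by finiteness), ENNReal.toReal_mul] at hfin
  simp only [ENNReal.toReal_one, ENNReal.toReal_ofNat] at hfin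
  linarith
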